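/- Let $\mathscr{H}$ be a complex Hilbert space. For $0<p<\infty$ let $\mathbb{B}_p(\mathscr{H})$ be the set of compact operators $X$ on $\mathscr{H}$ with $\|X\|_p:=\big(\sum_j s_j(X)^p\big)^{1/p}<\infty$, where the $s_j(X)$ are the singular values of $X$, that is, the nonzero eigenvalues of $|X|=(X^*X)^{1/2}$ counted with multiplicity. Let $0<p<\infty$ and $A,B\in\mathbb{B}_p(\mathscr{H})$. Then $A+B$ and $A-B$ belong to $\mathbb{B}_p(\mathscr{H})$. If $p\ge 2$, then $$2^{2-\frac p2}\big(\|A\|_p^2+\|B\|_p^2\big)^{\frac p2}\le\|A+B\|_p^p+\|A-B\|_p^p,$$ equivalently, $$2^{\frac 2p-1}\big(\|A\|_p^2+\|B\|_p^2\big)\le\left(\frac{\|A+B\|_p^p+\|A-B\|_p^p}{2}\right)^{\frac 2p}.$$ If $0<p\le 2$, both inequalities hold with $\le$ replaced by $\ge$. -/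

import Mathlib

noncomputable section

namespace Schatten

variable {H : Type*} [NormedAddCommGroup H] [InnerProductSpace ℂ H] [CompleteSpace H]

/-- The multiplicity of `s > 0` as a singular value of `X`, i.e. as an eigenvalue of
`|X| = (X* X)^{1/2}`: the dimension of the eigenspace of `X* X` at `s ^ 2`.
It is finite for every `s > 0` when `X` is compact. -/
def singularMultiplicity (X : H →L[ℂ] H) (s : ℝ) : ℕ :=
  Module.finrank ℂ (Module.End.eigenspace
    ((ContinuousLinearMap.adjoint X ∘L X : H →L[ℂ] H) : H →ₗ[ℂ] H) ((s : ℂ) ^ 2))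

/-- An index set for the nonzero singular values of a compact operator `X`, each repeated
according to its multiplicity. -/
abbrev Index (X : H →L[ℂ] H) : Type :=
  Σ s : Set.Ioi (0 : ℝ), Fin (singularMultiplicity X s)

/-- The singular value `s_j(X)`. The family `s_j(X)`, `j : Index X`, lists the nonzero singular
values of the compact operator `X` with multiplicity. -/
def singularValue (X : H →L[ℂ] H) (j : Index X) : ℝ := (j.1 : ℝ)

/-- `X` is in the Schatten class `B_p(H)`: it is compact and `∑ j, s_j(X) ^ p < ∞`. -/
def Mem (p : ℝ) (X : H →L[ℂ] H) : Prop :=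
  IsCompactOperator X ∧ Summable fun j : Index X => singularValue X j ^ p

/-- The Schatten (quasi-)norm `‖X‖_p = (∑ j, s_j(X) ^ p) ^ (1 / p)`, for `X` in `B_p(H)`. -/
def schattenNorm (p : ℝ) (X : H →L[ℂ] H) : ℝ :=
  (∑' j : Index X, singularValue X j ^ p) ^ (1 / p)

end Schatten

end

/-! Put `q = p / 2`. The parallelogram identity `|A+B|² + |A-B|² = 2(|A|² + |B|²)` reduces
everything to trace inequalities for positive compact `P`, `Q`: for `q ≥ 1`, `Tr P^q + Tr Q^q ≤ Tr
(P+Q)^q ≤ 2^(q-1) (Tr P^q + Tr Q^q)`, with both signs reversed for `q ≤ 1`. The right one for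
`|A±B|²` and the left one for `|A|²`, `|B|²` give the Clarkson-McCarthy inequality between
`2(‖A‖_p^p + ‖B‖_p^p)` and `‖A+B‖_p^p + ‖A-B‖_p^p`; convexity or concavity of `t ^ q` at the
midpoint of `‖A‖_p²` and `‖B‖_p²` finishes.

Both trace inequalities are Jensen's inequality for matrices built from eigenbases: `|⟪b i, c k⟫|²`
for the right one, `l i |⟪b i, c k⟫|² / g k` for the left one. Traces are sums in `ℝ≥0∞`, so
convergence is a conclusion rather than an assumption. -/

open scoped ENNReal NNReal InnerProductSpace

/-! ### Jensen's inequality for substochastic matrices -/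

section Substochastic

variable {ι κ : Type*}

/-- Total mass below 1 is harmless: in Hölder's inequality the mass enters with the exponent `1 -
q⁻¹ ≥ 0`. -/
theorem ENNReal.rpow_tsum_mul_le {q : ℝ} (hq : 1 ≤ q) {w : κ → ℝ≥0∞} (hw : ∑' k, w k ≤ 1)
    (f : κ → ℝ≥0∞) : (∑' k, w k * f k) ^ q ≤ ∑' k, w k * f k ^ q := by
  have hq0 : 0 < q := by linarith
  rw [← ENNReal.le_rpow_inv_iff hq0, ENNReal.tsum_eq_iSup_sum]
  refine iSup_le fun s => (ENNReal.inner_le_weight_mul_Lp_of_nonneg s hq w f).trans ?_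
  have h1 : (∑ i ∈ s, w i) ^ (1 - q⁻¹) ≤ 1 :=
    ENNReal.rpow_le_one ((ENNReal.sum_le_tsum s).trans hw) (by
      have := inv_le_one_of_one_le₀ hq
      linarith)
  calc _ ≤ 1 * (∑' k, w k * f k ^ q) ^ q⁻¹ := by
        gcongr
        exact ENNReal.sum_le_tsum s
    _ = _ := one_mul _

theorem ENNReal.tsum_mul_rpow_le {q : ℝ} (hq0 : 0 < q) (hq : q ≤ 1) {w : κ → ℝ≥0∞}
    (hw : ∑' k, w k ≤ 1) (f : κ → ℝ≥0∞) :
    ∑' k, w k * f k ^ q ≤ (∑' k, w k * f k) ^ q := by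
  have h := ENNReal.rpow_tsum_mul_le ((one_le_inv₀ hq0).2 hq) hw fun k => f k ^ q
  simp only [ENNReal.rpow_rpow_inv hq0.ne'] at h
  rwa [ENNReal.rpow_inv_le_iff hq0] at h

/-- Jensen in each row, then an exchange of sums. The column sums stay explicit because in the
superadditivity argument only the columns of two matrices taken together are controlled. -/
theorem ENNReal.tsum_rpow_tsum_mul_le {q : ℝ} (hq : 1 ≤ q) {m : ι → κ → ℝ≥0∞}
    (hm : ∀ i, ∑' k, m i k ≤ 1) (f : κ → ℝ≥0∞) :
    ∑' i, (∑' k, m i k * f k) ^ q ≤ ∑' k, (∑' i, m i k) * f k ^ q := by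
  simp_rw [← ENNReal.tsum_mul_right]
  rw [ENNReal.tsum_comm]
  exact ENNReal.tsum_le_tsum fun i => ENNReal.rpow_tsum_mul_le hq (hm i) f

theorem ENNReal.le_tsum_rpow_tsum_mul {q : ℝ} (hq0 : 0 < q) (hq : q ≤ 1) {m : ι → κ → ℝ≥0∞}
    (hm : ∀ i, ∑' k, m i k ≤ 1) (f : κ → ℝ≥0∞) :
    ∑' k, (∑' i, m i k) * f k ^ q ≤ ∑' i, (∑' k, m i k * f k) ^ q := by
  simp_rw [← ENNReal.tsum_mul_right]
  rw [ENNReal.tsum_comm]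
  exact ENNReal.tsum_le_tsum fun i => ENNReal.tsum_mul_rpow_le hq0 hq (hm i) f

theorem ENNReal.rpow_add_rpow_le_mul_rpow_add (a b : ℝ≥0∞) {q : ℝ} (hq0 : 0 < q) (hq : q ≤ 1) :
    a ^ q + b ^ q ≤ 2 ^ (1 - q) * (a + b) ^ q := by
  have h := ENNReal.rpow_add_le_mul_rpow_add_rpow (a ^ q) (b ^ q) ((one_le_inv₀ hq0).2 hq)
  rw [ENNReal.rpow_rpow_inv hq0.ne', ENNReal.rpow_rpow_inv hq0.ne',
    ENNReal.rpow_inv_le_iff hq0, ENNReal.mul_rpow_of_nonneg _ _ hq0.le, ← ENNReal.rpow_mul,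
    sub_mul, inv_mul_cancel₀ hq0.ne', one_mul] at h
  exact h

end Substochastic

/-! ### Operators diagonalized by a Hilbert basis, and convexity of the trace -/

namespace Schatten

variable {H : Type*} [NormedAddCommGroup H] [InnerProductSpace ℂ H]
  {ι κ τ : Type*}

/-- The Hilbert basis `b` diagonalizes `T`, with eigenvalues `l`. -/
def IsEigenbasis (T : H →L[ℂ] H) (b : HilbertBasis ι ℂ H) (l : ι → ℝ≥0) : Prop :=
  ∀ i, T (b i) = ((l i : ℝ) : ℂ) • b i

theorem IsEigenbasis.hasSum {T : H →L[ℂ] H} {b : HilbertBasis ι ℂ H} {l : ι → ℝ≥0}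
    (h : IsEigenbasis T b l) (x : H) :
    HasSum (fun i => (l i : ℝ) * ‖⟪b i, x⟫_ℂ‖ ^ 2) (⟪x, T x⟫_ℂ).re := by
  have h1 := ((innerSL ℂ x ∘L T).hasSum (b.hasSum_repr x))
  have h2 := Complex.hasSum_re h1
  simp only [ContinuousLinearMap.comp_apply, map_smul, h _, innerSL_apply_apply,
    b.repr_apply_apply, smul_eq_mul] at h2
  convert h2 using 2 with i
  rw [← inner_conj_symm x (b i), mul_left_comm, Complex.mul_conj, Complex.re_ofReal_mul,
    Complex.ofReal_re, Complex.normSq_eq_norm_sq]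

theorem IsEigenbasis.tsum {T : H →L[ℂ] H} {b : HilbertBasis ι ℂ H} {l : ι → ℝ≥0}
    (h : IsEigenbasis T b l) (x : H) :
    ∑' i, ENNReal.ofReal (‖⟪b i, x⟫_ℂ‖ ^ 2) * l i = ENNReal.ofReal (⟪x, T x⟫_ℂ).re := by
  rw [← (h.hasSum x).tsum_eq,
    ENNReal.ofReal_tsum_of_nonneg (fun i => by positivity) (h.hasSum x).summable]
  refine tsum_congr fun i => ?_
  rw [ENNReal.ofReal_mul (by positivity), ENNReal.ofReal_coe_nnreal, mul_comm]

theorem tsum_norm_inner_sq (b : HilbertBasis ι ℂ H) (x : H) :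
    ∑' i, ENNReal.ofReal (‖⟪b i, x⟫_ℂ‖ ^ 2) = ENNReal.ofReal (‖x‖ ^ 2) := by
  have h : IsEigenbasis (ContinuousLinearMap.id ℂ H) b 1 := fun i => by simp
  have := h.tsum x
  simp only [Pi.one_apply, ENNReal.coe_one, mul_one, ContinuousLinearMap.id_apply] at this
  rw [this, inner_self_eq_norm_sq_to_K]
  norm_cast

theorem tsum_norm_inner_sq_basis (b : HilbertBasis ι ℂ H) (c : HilbertBasis κ ℂ H) (k : κ) :
    ∑' i, ENNReal.ofReal (‖⟪b i, c k⟫_ℂ‖ ^ 2) = 1 := by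
  rw [tsum_norm_inner_sq, c.orthonormal.1]; simp

theorem tsum_norm_inner_sq_basis' (b : HilbertBasis ι ℂ H) (c : HilbertBasis κ ℂ H) (i : ι) :
    ∑' k, ENNReal.ofReal (‖⟪b i, c k⟫_ℂ‖ ^ 2) = 1 := by
  rw [← tsum_norm_inner_sq_basis c b i]
  exact tsum_congr fun k => by rw [norm_inner_symm]

theorem IsEigenbasis.re_inner_self {T : H →L[ℂ] H} {b : HilbertBasis ι ℂ H} {l : ι → ℝ≥0}
    (h : IsEigenbasis T b l) (i : ι) : (⟪b i, T (b i)⟫_ℂ).re = l i := by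
  rw [h i, inner_smul_right, inner_self_eq_norm_sq_to_K, b.orthonormal.1]
  simp

theorem IsEigenbasis.re_inner_nonneg {T : H →L[ℂ] H} {b : HilbertBasis ι ℂ H} {l : ι → ℝ≥0}
    (h : IsEigenbasis T b l) (x : H) : 0 ≤ (⟪x, T x⟫_ℂ).re :=
  (h.hasSum x).nonneg fun i => by positivity

/-- The diagonal of `T` in the basis `c` is the image of its eigenvalues under the doubly stochastic
matrix `|⟪b i, c k⟫|²`. -/
theorem IsEigenbasis.tsum_rpow_re_inner_le {T : H →L[ℂ] H} {b : HilbertBasis ι ℂ H}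
    {l : ι → ℝ≥0} (h : IsEigenbasis T b l) (c : HilbertBasis κ ℂ H) {q : ℝ} (hq : 1 ≤ q) :
    ∑' k, ENNReal.ofReal (⟪c k, T (c k)⟫_ℂ).re ^ q ≤ ∑' i, (l i : ℝ≥0∞) ^ q := by
  have := ENNReal.tsum_rpow_tsum_mul_le hq
    (m := fun k i => ENNReal.ofReal (‖⟪b i, c k⟫_ℂ‖ ^ 2))
    (fun k => (tsum_norm_inner_sq_basis b c k).le) fun i => (l i : ℝ≥0∞)
  simp_rw [h.tsum, tsum_norm_inner_sq_basis', one_mul] at this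
  exact this

theorem IsEigenbasis.le_tsum_rpow_re_inner {T : H →L[ℂ] H} {b : HilbertBasis ι ℂ H}
    {l : ι → ℝ≥0} (h : IsEigenbasis T b l) (c : HilbertBasis κ ℂ H) {q : ℝ} (hq0 : 0 < q)
    (hq : q ≤ 1) :
    ∑' i, (l i : ℝ≥0∞) ^ q ≤ ∑' k, ENNReal.ofReal (⟪c k, T (c k)⟫_ℂ).re ^ q := by
  have := ENNReal.le_tsum_rpow_tsum_mul hq0 hq
    (m := fun k i => ENNReal.ofReal (‖⟪b i, c k⟫_ℂ‖ ^ 2))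
    (fun k => (tsum_norm_inner_sq_basis b c k).le) fun i => (l i : ℝ≥0∞)
  simp_rw [h.tsum, tsum_norm_inner_sq_basis', one_mul] at this
  exact this

section Add

variable {P Q : H →L[ℂ] H} {b : HilbertBasis ι ℂ H} {l : ι → ℝ≥0} {d : HilbertBasis κ ℂ H}
  {r : κ → ℝ≥0} {c : HilbertBasis τ ℂ H} {g : τ → ℝ≥0}

theorem IsEigenbasis.coe_eigenvalue_add (hP : IsEigenbasis P b l) (hQ : IsEigenbasis Q d r)
    (hC : IsEigenbasis (P + Q) c g) (k : τ) :
    (g k : ℝ≥0∞) =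
      ENNReal.ofReal (⟪c k, P (c k)⟫_ℂ).re + ENNReal.ofReal (⟪c k, Q (c k)⟫_ℂ).re := by
  rw [← ENNReal.ofReal_add (hP.re_inner_nonneg _) (hQ.re_inner_nonneg _), ← Complex.add_re,
    ← inner_add_right, ← add_apply, hC.re_inner_self,
    ENNReal.ofReal_coe_nnreal]

theorem IsEigenbasis.tsum_rpow_add_le_mul (hP : IsEigenbasis P b l) (hQ : IsEigenbasis Q d r)
    (hC : IsEigenbasis (P + Q) c g) {q : ℝ} (hq : 1 ≤ q) :
    ∑' k, (g k : ℝ≥0∞) ^ q ≤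
      2 ^ (q - 1) * (∑' i, (l i : ℝ≥0∞) ^ q + ∑' j, (r j : ℝ≥0∞) ^ q) := by
  calc _ ≤ ∑' k, 2 ^ (q - 1) * (ENNReal.ofReal (⟪c k, P (c k)⟫_ℂ).re ^ q +
          ENNReal.ofReal (⟪c k, Q (c k)⟫_ℂ).re ^ q) := by
        refine ENNReal.tsum_le_tsum fun k => ?_
        rw [hP.coe_eigenvalue_add hQ hC]
        exact ENNReal.rpow_add_le_mul_rpow_add_rpow _ _ hq
    _ ≤ _ := by
        rw [ENNReal.tsum_mul_left, ENNReal.tsum_add]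
        gcongr
        · exact hP.tsum_rpow_re_inner_le c hq
        · exact hQ.tsum_rpow_re_inner_le c hq

theorem IsEigenbasis.tsum_rpow_le_mul_add (hP : IsEigenbasis P b l) (hQ : IsEigenbasis Q d r)
    (hC : IsEigenbasis (P + Q) c g) {q : ℝ} (hq0 : 0 < q) (hq : q ≤ 1) :
    ∑' i, (l i : ℝ≥0∞) ^ q + ∑' j, (r j : ℝ≥0∞) ^ q ≤
      2 ^ (1 - q) * ∑' k, (g k : ℝ≥0∞) ^ q := by
  calc _ ≤ ∑' k, (ENNReal.ofReal (⟪c k, P (c k)⟫_ℂ).re ^ q +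
          ENNReal.ofReal (⟪c k, Q (c k)⟫_ℂ).re ^ q) := by
        rw [ENNReal.tsum_add]
        gcongr
        · exact hP.le_tsum_rpow_re_inner c hq0 hq
        · exact hQ.le_tsum_rpow_re_inner c hq0 hq
    _ ≤ _ := by
        rw [← ENNReal.tsum_mul_left]
        refine ENNReal.tsum_le_tsum fun k => ?_
        rw [hP.coe_eigenvalue_add hQ hC]
        exact ENNReal.rpow_add_rpow_le_mul_rpow_add _ _ hq0 hq

end Add

/-! ### The substochastic matrix attached to `P ≤ C` -/

section Domination

variable {P C : H →L[ℂ] H} {b : HilbertBasis ι ℂ H} {l : ι → ℝ≥0}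
  {c : HilbertBasis τ ℂ H} {g : τ → ℝ≥0}

/-- If `P ≤ C` and `v` is a unit eigenvector of `P` with eigenvalue `p`, then
`p ⟪v, C⁻¹ v⟫ ≤ 1`. -/
theorem IsEigenbasis.sum_div_le_one (hP : IsEigenbasis P b l) (hC : IsEigenbasis C c g)
    (hPC : ∀ x, (⟪x, P x⟫_ℂ).re ≤ (⟪x, C x⟫_ℂ).re) (i : ι) (s : Finset τ) :
    ∑ k ∈ s, (l i : ℝ) * ‖⟪b i, c k⟫_ℂ‖ ^ 2 / g k ≤ 1 := by
  classical
  set t : ℝ := ∑ k ∈ s, ‖⟪b i, c k⟫_ℂ‖ ^ 2 / g k with ht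
  have ht0 : 0 ≤ t := Finset.sum_nonneg fun k _ => by positivity
  -- `w` is a truncation of `C⁻¹ (b i)`, with `0⁻¹ = 0` on the kernel. Then `⟪b i, w⟫` and `⟪w, C
  -- w⟫` both equal `t`, and `P ≤ C` tested on `w` yields `l i * t² ≤ t`.
  let w : H := ∑ k ∈ s, (((g k : ℝ)⁻¹ : ℝ) * ⟪c k, b i⟫_ℂ) • c k
  have hcw : ∀ k, ⟪c k, w⟫_ℂ = if k ∈ s then (((g k : ℝ)⁻¹ : ℝ) * ⟪c k, b i⟫_ℂ) else 0 := by
    intro k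
    simp only [w, inner_sum, inner_smul_right, orthonormal_iff_ite.1 c.orthonormal, mul_ite,
      mul_one, mul_zero, Finset.sum_ite_eq]
  have hbw : ⟪b i, w⟫_ℂ = (t : ℂ) := by
    simp only [w, inner_sum, inner_smul_right, ht, Complex.ofReal_sum]
    refine Finset.sum_congr rfl fun k _ => ?_
    rw [mul_assoc, ← inner_conj_symm (c k) (b i), mul_comm (starRingEnd ℂ _), Complex.mul_conj,
      Complex.normSq_eq_norm_sq, div_eq_inv_mul]
    push_cast
    rfl
  have hCw : (⟪w, C w⟫_ℂ).re = t := by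
    rw [← (hC.hasSum w).tsum_eq, tsum_eq_sum (s := s)]
    · refine Finset.sum_congr rfl fun k hk => ?_
      rw [hcw, if_pos hk, norm_mul, Complex.norm_real, mul_pow, norm_inner_symm (c k)]
      rcases eq_or_ne (g k : ℝ) 0 with h0 | h0
      · simp [h0]
      · rw [norm_inv, Real.norm_eq_abs, inv_pow, sq_abs]
        field_simp
    · intro k hk
      simp [hcw, hk]
  have hPw : (l i : ℝ) * t ^ 2 ≤ t := by
    have h1 := le_hasSum (hP.hasSum w) i fun j _ => by positivity
    rw [hbw, Complex.norm_real, Real.norm_eq_abs, sq_abs] at h1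
    exact h1.trans ((hPC w).trans hCw.le)
  have hsum : ∑ k ∈ s, (l i : ℝ) * ‖⟪b i, c k⟫_ℂ‖ ^ 2 / g k = l i * t := by
    rw [ht, Finset.mul_sum]
    exact Finset.sum_congr rfl fun k _ => mul_div_assoc _ _ _
  rw [hsum]
  rcases ht0.eq_or_lt with h0 | h0
  · rw [← h0]; simp
  · exact le_of_mul_le_mul_right (by rw [mul_assoc, ← sq, one_mul]; exact hPw) h0

theorem IsEigenbasis.tsum_div_le_one (hP : IsEigenbasis P b l) (hC : IsEigenbasis C c g)
    (hPC : ∀ x, (⟪x, P x⟫_ℂ).re ≤ (⟪x, C x⟫_ℂ).re) (i : ι) :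
    ∑' k, ENNReal.ofReal ((l i : ℝ) * ‖⟪b i, c k⟫_ℂ‖ ^ 2 / g k) ≤ 1 := by
  rw [ENNReal.tsum_eq_iSup_sum]
  refine iSup_le fun s => ?_
  rw [← ENNReal.ofReal_sum_of_nonneg fun k _ => by positivity, ENNReal.ofReal_le_one]
  exact hP.sum_div_le_one hC hPC i s

theorem IsEigenbasis.tsum_div_mul (hP : IsEigenbasis P b l) (hC : IsEigenbasis C c g)
    (hPC : ∀ x, (⟪x, P x⟫_ℂ).re ≤ (⟪x, C x⟫_ℂ).re) (i : ι) :
    ∑' k, ENNReal.ofReal ((l i : ℝ) * ‖⟪b i, c k⟫_ℂ‖ ^ 2 / g k) * g k = l i := by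
  have h : ∀ k, ENNReal.ofReal ((l i : ℝ) * ‖⟪b i, c k⟫_ℂ‖ ^ 2 / g k) * g k =
      l i * ENNReal.ofReal (‖⟪c k, b i⟫_ℂ‖ ^ 2) := by
    intro k
    have h1 : (l i : ℝ) * ‖⟪b i, c k⟫_ℂ‖ ^ 2 ≤ g k :=
      (le_hasSum (hP.hasSum (c k)) i fun j _ => by positivity).trans
        ((hPC _).trans (hC.re_inner_self k).le)
    rw [← ENNReal.ofReal_coe_nnreal, ← ENNReal.ofReal_coe_nnreal,
      ← ENNReal.ofReal_mul (by positivity), ← ENNReal.ofReal_mul (by positivity),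
      div_mul_cancel_of_imp, norm_inner_symm]
    -- Where `g k = 0`, domination forces the numerator to vanish too, so cancelling `g k` loses
    -- nothing.
    intro h0
    exact le_antisymm (h1.trans h0.le) (by positivity)
  simp_rw [h]
  rw [ENNReal.tsum_mul_left, tsum_norm_inner_sq_basis, mul_one]

theorem IsEigenbasis.tsum_div_right (hP : IsEigenbasis P b l) (k : τ) :
    ∑' i, ENNReal.ofReal ((l i : ℝ) * ‖⟪b i, c k⟫_ℂ‖ ^ 2 / g k) =
      ENNReal.ofReal ((⟪c k, P (c k)⟫_ℂ).re / g k) := by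
  have h := (hP.hasSum (c k)).div_const (g k : ℝ)
  rw [← h.tsum_eq, ENNReal.ofReal_tsum_of_nonneg (fun i => by positivity) h.summable]

end Domination

/-! ### Superadditivity and subadditivity of `Tr P^q` -/

section Add

variable {P Q : H →L[ℂ] H} {b : HilbertBasis ι ℂ H} {l : ι → ℝ≥0} {d : HilbertBasis κ ℂ H}
  {r : κ → ℝ≥0} {c : HilbertBasis τ ℂ H} {g : τ → ℝ≥0}

/-- The `k`-th column sums of the two matrices add up to `⟪c k, (P + Q) (c k)⟫ / g k = 1`; if `g k =
0`, the factor `g k ^ q` vanishes. -/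
theorem IsEigenbasis.tsum_div_rpow_add (hP : IsEigenbasis P b l) (hQ : IsEigenbasis Q d r)
    (hC : IsEigenbasis (P + Q) c g) {q : ℝ} (hq : 0 < q) :
    ∑' k, (∑' i, ENNReal.ofReal ((l i : ℝ) * ‖⟪b i, c k⟫_ℂ‖ ^ 2 / g k)) * (g k : ℝ≥0∞) ^ q +
      ∑' k, (∑' j, ENNReal.ofReal ((r j : ℝ) * ‖⟪d j, c k⟫_ℂ‖ ^ 2 / g k)) * (g k : ℝ≥0∞) ^ q =
      ∑' k, (g k : ℝ≥0∞) ^ q := by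
  rw [← ENNReal.tsum_add]
  refine tsum_congr fun k => ?_
  rw [hP.tsum_div_right, hQ.tsum_div_right, ← add_mul, ← ENNReal.ofReal_add
    (div_nonneg (hP.re_inner_nonneg _) (by positivity))
    (div_nonneg (hQ.re_inner_nonneg _) (by positivity)), ← add_div, ← Complex.add_re,
    ← inner_add_right, ← add_apply, hC.re_inner_self]
  rcases eq_or_ne (g k) 0 with h0 | h0
  · simp [h0, hq]
  · rw [div_self (by exact_mod_cast h0), ENNReal.ofReal_one, one_mul]

theorem IsEigenbasis.re_inner_le_add_left (hQ : IsEigenbasis Q d r) (x : H) :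
    (⟪x, P x⟫_ℂ).re ≤ (⟪x, (P + Q) x⟫_ℂ).re := by
  rw [add_apply, inner_add_right, Complex.add_re]
  linarith [hQ.re_inner_nonneg x]

theorem IsEigenbasis.re_inner_le_add_right (hP : IsEigenbasis P b l) (x : H) :
    (⟪x, Q x⟫_ℂ).re ≤ (⟪x, (P + Q) x⟫_ℂ).re := by
  rw [add_comm]
  exact hP.re_inner_le_add_left x

theorem IsEigenbasis.tsum_rpow_superadditive (hP : IsEigenbasis P b l)
    (hQ : IsEigenbasis Q d r) (hC : IsEigenbasis (P + Q) c g) {q : ℝ} (hq : 1 ≤ q) :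
    ∑' i, (l i : ℝ≥0∞) ^ q + ∑' j, (r j : ℝ≥0∞) ^ q ≤ ∑' k, (g k : ℝ≥0∞) ^ q := by
  have h1 := ENNReal.tsum_rpow_tsum_mul_le hq
    (hP.tsum_div_le_one hC hQ.re_inner_le_add_left) fun k => (g k : ℝ≥0∞)
  have h2 := ENNReal.tsum_rpow_tsum_mul_le hq
    (hQ.tsum_div_le_one hC hP.re_inner_le_add_right) fun k => (g k : ℝ≥0∞)
  simp_rw [hP.tsum_div_mul hC hQ.re_inner_le_add_left] at h1
  simp_rw [hQ.tsum_div_mul hC hP.re_inner_le_add_right] at h2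
  exact (add_le_add h1 h2).trans (hP.tsum_div_rpow_add hQ hC (by linarith)).le

theorem IsEigenbasis.tsum_rpow_subadditive (hP : IsEigenbasis P b l)
    (hQ : IsEigenbasis Q d r) (hC : IsEigenbasis (P + Q) c g) {q : ℝ} (hq0 : 0 < q)
    (hq : q ≤ 1) :
    ∑' k, (g k : ℝ≥0∞) ^ q ≤ ∑' i, (l i : ℝ≥0∞) ^ q + ∑' j, (r j : ℝ≥0∞) ^ q := by
  have h1 := ENNReal.le_tsum_rpow_tsum_mul hq0 hq
    (hP.tsum_div_le_one hC hQ.re_inner_le_add_left) fun k => (g k : ℝ≥0∞)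
  have h2 := ENNReal.le_tsum_rpow_tsum_mul hq0 hq
    (hQ.tsum_div_le_one hC hP.re_inner_le_add_right) fun k => (g k : ℝ≥0∞)
  simp_rw [hP.tsum_div_mul hC hQ.re_inner_le_add_left] at h1
  simp_rw [hQ.tsum_div_mul hC hP.re_inner_le_add_right] at h2
  exact (hP.tsum_div_rpow_add hQ hC hq0).symm.le.trans (add_le_add h1 h2)

end Add

end Schatten

/-! ### Spectral theorem and passage to singular values -/

namespace Schatten

variable {H : Type*} [NormedAddCommGroup H] [InnerProductSpace ℂ H]

open scoped ComplexOrder in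
theorem eigenvalue_eq_sq {T : H →L[ℂ] H} (hT : T.IsPositive) {μ : ℂ}
    {x : H} (hx : x ≠ 0) (h : T x = μ • x) (hμ : μ ≠ 0) : ∃ s : ℝ, 0 < s ∧ μ = (s : ℂ) ^ 2 := by
  have h1 : 0 ≤ ⟪x, T x⟫_ℂ := hT.inner_nonneg_right x
  have h2 : (0 : ℂ) < (‖x‖ ^ 2 : ℝ) := by
    rw [Complex.zero_lt_real]
    positivity
  rw [h, inner_smul_right, inner_self_eq_norm_sq_to_K] at h1
  have h3 : 0 ≤ μ := by
    refine le_of_mul_le_mul_right (a := ((‖x‖ ^ 2 : ℝ) : ℂ)) ?_ h2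
    rw [zero_mul]
    exact_mod_cast h1
  obtain ⟨hre, him⟩ := Complex.nonneg_iff.1 h3
  have hμr : μ = (μ.re : ℂ) := Complex.ext (by simp) (by simp [← him])
  have hpos : 0 < μ.re := hre.lt_of_ne fun h0 => hμ (by rw [hμr, ← h0, Complex.ofReal_zero])
  refine ⟨Real.sqrt μ.re, Real.sqrt_pos.2 hpos, ?_⟩
  rw [← Complex.ofReal_pow, Real.sq_sqrt hpos.le, ← hμr]

theorem IsEigenbasis.two_smul {ι : Type*} {T : H →L[ℂ] H} {b : HilbertBasis ι ℂ H}
    {l : ι → ℝ≥0} (h : IsEigenbasis T b l) : IsEigenbasis ((2 : ℂ) • T) b (2 * l) := fun i => by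
  rw [smul_apply, h i, smul_smul]
  simp

variable [CompleteSpace H]

theorem apply_eq_zero_of_orthogonal_eigenspaces {T : H →L[ℂ] H} (hc : IsCompactOperator T)
    (hT : T.IsPositive) {x : H}
    (hx : ∀ s : ℝ, 0 < s → ∀ y ∈ Module.End.eigenspace (T : H →ₗ[ℂ] H) ((s : ℂ) ^ 2),
      ⟪y, x⟫_ℂ = 0) : T x = 0 := by
  have hsymm : (T : H →ₗ[ℂ] H).IsSymmetric := hT.isSymmetric
  have hbot := ContinuousLinearMap.orthogonalComplement_iSup_eigenspaces_eq_bot hc hsymm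
  -- `T x` is shown orthogonal to every eigenspace: by assumption on `x` if `μ ≠ 0`, and through the
  -- factor `μ` if `μ = 0`.
  rw [← Submodule.mem_bot ℂ, ← hbot, ← Submodule.iInf_orthogonal, Submodule.mem_iInf]
  intro μ
  rw [Submodule.mem_orthogonal]
  intro y hy
  have hTy : T y = μ • y := Module.End.mem_eigenspace_iff.1 hy
  have h1 : ⟪y, T x⟫_ℂ = ⟪T y, x⟫_ℂ := (hsymm y x).symm
  rw [h1, hTy, inner_smul_left]
  rcases eq_or_ne μ 0 with rfl | hμ
  · simp
  rcases eq_or_ne y 0 with rfl | hy0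
  · simp
  obtain ⟨s, hs, rfl⟩ := eigenvalue_eq_sq hT hy0 hTy hμ
  rw [hx s hs y hy, mul_zero]

/-- Spectral theorem for compact positive operators, with the nonzero eigenvalues listed with
multiplicity. -/
theorem exists_isEigenbasis {T : H →L[ℂ] H} (hc : IsCompactOperator T) (hT : T.IsPositive) :
    ∃ (w : Set H) (b : HilbertBasis w ℂ H) (l : w → ℝ≥0), IsEigenbasis T b l ∧
      ∀ q : ℝ, 0 < q → ∑' i, (l i : ℝ≥0∞) ^ q =
        ∑' j : Σ s : Set.Ioi (0 : ℝ),
            Fin (Module.finrank ℂ (Module.End.eigenspace (T : H →ₗ[ℂ] H) ((s : ℂ) ^ 2))),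
          ENNReal.ofReal ((j.1 : ℝ) ^ 2) ^ q := by
  have hsymm : (T : H →ₗ[ℂ] H).IsSymmetric := hT.isSymmetric
  have hfin : ∀ s : Set.Ioi (0 : ℝ),
      FiniteDimensional ℂ (Module.End.eigenspace (T : H →ₗ[ℂ] H) ((s : ℂ) ^ 2)) := fun s =>
    ContinuousLinearMap.finite_dimensional_eigenspace hc _
      (pow_ne_zero _ (Complex.ofReal_ne_zero.2 s.2.ne'))
  have hinj : Function.Injective fun s : Set.Ioi (0 : ℝ) => ((s : ℂ) ^ 2) := by
    intro s t hst
    have h1 : (s : ℝ) ^ 2 = (t : ℝ) ^ 2 := by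
      dsimp only at hst
      exact_mod_cast hst
    exact Subtype.ext ((pow_left_inj₀ (le_of_lt s.2) (le_of_lt t.2) two_ne_zero).1 h1)
  let v : (Σ s : Set.Ioi (0 : ℝ),
      Fin (Module.finrank ℂ (Module.End.eigenspace (T : H →ₗ[ℂ] H) ((s : ℂ) ^ 2)))) → H :=
    fun j => (stdOrthonormalBasis ℂ
      (Module.End.eigenspace (T : H →ₗ[ℂ] H) (((j.1 : ℝ) : ℂ) ^ 2)) j.2 : H)
  have hv : Orthonormal ℂ v :=
    (hsymm.orthogonalFamily_eigenspaces.comp hinj).orthonormal_sigma_orthonormal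
      fun s => (stdOrthonormalBasis ℂ
        (Module.End.eigenspace (T : H →ₗ[ℂ] H) ((s : ℂ) ^ 2))).orthonormal
  have hTv : ∀ j, T (v j) = (((j.1 : ℝ) ^ 2 : ℝ) : ℂ) • v j := fun j => by
    push_cast
    exact Module.End.mem_eigenspace_iff.1 (stdOrthonormalBasis ℂ
      (Module.End.eigenspace (T : H →ₗ[ℂ] H) (((j.1 : ℝ) : ℂ) ^ 2)) j.2).2
  obtain ⟨w, b, hw, hb⟩ := hv.toSubtypeRange.exists_hilbertBasis_extension
  let l : w → ℝ≥0 := fun i => (⟪b i, T (b i)⟫_ℂ).re.toNNReal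
  let e : (Σ s : Set.Ioi (0 : ℝ),
      Fin (Module.finrank ℂ (Module.End.eigenspace (T : H →ₗ[ℂ] H) ((s : ℂ) ^ 2)))) → w :=
    fun j => ⟨v j, hw ⟨j, rfl⟩⟩
  have hbe : ∀ j, b (e j) = v j := fun j => by rw [hb]
  have he : Function.Injective e := fun i j hij =>
    hv.linearIndependent.injective (congrArg Subtype.val hij)
  have hle : ∀ j, l (e j) = ((j.1 : ℝ) ^ 2).toNNReal := fun j => by
    simp only [l, hbe, hTv, inner_smul_right, inner_self_eq_norm_sq_to_K, hv.1]
    norm_num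
    rw [← Complex.ofReal_pow, Complex.ofReal_re]
  -- The vectors added to complete the basis lie in the kernel, so for `q > 0` they contribute
  -- nothing to the sum.
  have hzero : ∀ i ∉ Set.range e, T (b i) = 0 := by
    intro i hi
    refine apply_eq_zero_of_orthogonal_eigenspaces hc hT fun s hs y hy => ?_
    have : FiniteDimensional ℂ (Module.End.eigenspace (T : H →ₗ[ℂ] H) ((s : ℂ) ^ 2)) :=
      hfin ⟨s, hs⟩
    have h := (stdOrthonormalBasis ℂ
      (Module.End.eigenspace (T : H →ₗ[ℂ] H) ((s : ℂ) ^ 2))).sum_repr ⟨y, hy⟩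
    replace h := congrArg Subtype.val h
    simp only [Submodule.coe_sum, Submodule.coe_smul] at h
    rw [← h, sum_inner]
    refine Finset.sum_eq_zero fun k _ => ?_
    rw [inner_smul_left]
    have h0 : ⟪b (e ⟨⟨s, hs⟩, k⟩), b i⟫_ℂ = 0 :=
      b.orthonormal.2 fun h => hi ⟨_, h⟩
    rw [hbe] at h0
    exact mul_eq_zero_of_right _ h0
  refine ⟨w, b, l, fun i => ?_, fun q hq => ?_⟩
  · by_cases hi : i ∈ Set.range e
    · obtain ⟨j, rfl⟩ := hi
      rw [hle, hbe, hTv, Real.coe_toNNReal _ (by positivity)]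
    · simp [l, hzero i hi]
  · rw [← he.tsum_eq]
    · exact tsum_congr fun j => by rw [hle]; rfl
    · intro i hi
      by_contra hn
      exact hi (by simp [l, hzero i hn, hq])

theorem exists_isEigenbasis_adjoint_comp_self {X : H →L[ℂ] H} (hX : IsCompactOperator X)
    {p : ℝ} (hp : 0 < p) :
    ∃ (w : Set H) (b : HilbertBasis w ℂ H) (l : w → ℝ≥0),
      IsEigenbasis (ContinuousLinearMap.adjoint X ∘L X) b l ∧
      ∑' i, (l i : ℝ≥0∞) ^ (p / 2) =
        ∑' j : Index X, ENNReal.ofReal (singularValue X j ^ p) := by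
  obtain ⟨w, b, l, h, hl⟩ := exists_isEigenbasis (hX.clm_comp (ContinuousLinearMap.adjoint X))
    X.isPositive_adjoint_comp_self
  refine ⟨w, b, l, h, (hl _ (half_pos hp)).trans (tsum_congr fun j => ?_)⟩
  have hj : (0 : ℝ) < j.1 := j.1.2
  rw [ENNReal.ofReal_rpow_of_nonneg (by positivity) (by positivity), ← Real.rpow_natCast,
    ← Real.rpow_mul hj.le]
  congr 2
  push_cast
  ring

theorem singularValue_pos (X : H →L[ℂ] H) (j : Index X) : 0 < singularValue X j := j.1.2

theorem mem_iff {p : ℝ} {X : H →L[ℂ] H} :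
    Mem p X ↔ IsCompactOperator X ∧ ∑' j : Index X, ENNReal.ofReal (singularValue X j ^ p) ≠ ∞ := by
  refine and_congr_right fun _ => ⟨fun h => h.tsum_ofReal_ne_top, fun h => ?_⟩
  refine (ENNReal.summable_toReal h).congr fun j => ?_
  exact ENNReal.toReal_ofReal (Real.rpow_nonneg (singularValue_pos X j).le p)

theorem tsum_singularValue_rpow_nonneg (p : ℝ) (X : H →L[ℂ] H) :
    0 ≤ ∑' j : Index X, singularValue X j ^ p :=
  tsum_nonneg fun j => Real.rpow_nonneg (singularValue_pos X j).le p

theorem Mem.tsum_ofReal {p : ℝ} {X : H →L[ℂ] H} (h : Mem p X) :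
    ∑' j : Index X, ENNReal.ofReal (singularValue X j ^ p) =
      ENNReal.ofReal (∑' j : Index X, singularValue X j ^ p) :=
  (ENNReal.ofReal_tsum_of_nonneg
    (fun j => Real.rpow_nonneg (singularValue_pos X j).le p) h.2).symm

theorem schattenNorm_rpow {p : ℝ} (hp : 0 < p) (X : H →L[ℂ] H) :
    schattenNorm p X ^ p = ∑' j : Index X, singularValue X j ^ p := by
  rw [schattenNorm, one_div, Real.rpow_inv_rpow (tsum_singularValue_rpow_nonneg p X) hp.ne']

theorem schattenNorm_nonneg (p : ℝ) (X : H →L[ℂ] H) : 0 ≤ schattenNorm p X :=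
  Real.rpow_nonneg (tsum_singularValue_rpow_nonneg p X) _

theorem adjoint_comp_self_add_sub (A B : H →L[ℂ] H) :
    ContinuousLinearMap.adjoint (A + B) ∘L (A + B) +
        ContinuousLinearMap.adjoint (A - B) ∘L (A - B) =
      (2 : ℂ) • (ContinuousLinearMap.adjoint A ∘L A + ContinuousLinearMap.adjoint B ∘L B) := by
  ext x
  simp only [map_add, map_sub, add_apply, sub_apply, ContinuousLinearMap.comp_apply,
    two_smul]
  abel

/-- The power sums of the singular values of `A ± B` against those of `A` and `B`. -/
theorem tsum_singularValue_rpow_add_sub {p : ℝ} (hp : 0 < p) {A B : H →L[ℂ] H}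
    (hA : Mem p A) (hB : Mem p B) :
    Mem p (A + B) ∧ Mem p (A - B) ∧
    (2 ≤ p → 2 * (∑' j : Index A, singularValue A j ^ p + ∑' j : Index B, singularValue B j ^ p) ≤
      ∑' j : Index (A + B), singularValue (A + B) j ^ p +
        ∑' j : Index (A - B), singularValue (A - B) j ^ p) ∧
    (p ≤ 2 → ∑' j : Index (A + B), singularValue (A + B) j ^ p +
        ∑' j : Index (A - B), singularValue (A - B) j ^ p ≤
      2 * (∑' j : Index A, singularValue A j ^ p + ∑' j : Index B, singularValue B j ^ p)) := by
  have hq : 0 < p / 2 := half_pos hp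
  have hadd : IsCompactOperator (A + B) := hA.1.add hB.1
  have hsub : IsCompactOperator (A - B) := hA.1.sub hB.1
  obtain ⟨_, bA, lA, eA, sA⟩ := exists_isEigenbasis_adjoint_comp_self hA.1 hp
  obtain ⟨_, bB, lB, eB, sB⟩ := exists_isEigenbasis_adjoint_comp_self hB.1 hp
  obtain ⟨_, bX, lX, eX, sX⟩ := exists_isEigenbasis_adjoint_comp_self hadd hp
  obtain ⟨_, bY, lY, eY, sY⟩ := exists_isEigenbasis_adjoint_comp_self hsub hp
  obtain ⟨_, b, l, e, -⟩ := exists_isEigenbasis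
    ((hA.1.clm_comp (ContinuousLinearMap.adjoint A)).add
      (hB.1.clm_comp (ContinuousLinearMap.adjoint B)))
    (A.isPositive_adjoint_comp_self.add B.isPositive_adjoint_comp_self)
  have e2 := e.two_smul
  -- `b` now also diagonalizes `|A+B|² + |A-B|²`, with eigenvalues `2 * l`.
  rw [← adjoint_comp_self_add_sub] at e2
  have hl2 : ∑' i, (((2 * l) i : ℝ≥0) : ℝ≥0∞) ^ (p / 2) =
      2 ^ (p / 2) * ∑' i, (l i : ℝ≥0∞) ^ (p / 2) := by
    rw [← ENNReal.tsum_mul_left]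
    refine tsum_congr fun i => ?_
    rw [← ENNReal.mul_rpow_of_nonneg _ _ hq.le]
    simp
  have hpow : ∀ x : ℝ, (2 : ℝ≥0∞) ^ x ≠ ∞ := fun x =>
    ENNReal.rpow_ne_top_of_ne_zero two_ne_zero ENNReal.ofNat_ne_top
  have h2 : (2 : ℝ≥0∞) ^ (1 - p / 2) * 2 ^ (p / 2) = 2 := by
    rw [← ENNReal.rpow_add _ _ two_ne_zero ENNReal.ofNat_ne_top, sub_add_cancel, ENNReal.rpow_one]
  have hfA := (mem_iff.1 hA).2
  have hfB := (mem_iff.1 hB).2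
  have upper : p ≤ 2 →
      ∑' i, (lX i : ℝ≥0∞) ^ (p / 2) + ∑' i, (lY i : ℝ≥0∞) ^ (p / 2) ≤
        2 * (∑' i, (lA i : ℝ≥0∞) ^ (p / 2) + ∑' i, (lB i : ℝ≥0∞) ^ (p / 2)) := fun hp2 => by
    have h1 := eX.tsum_rpow_le_mul_add eY e2 hq (by linarith)
    rw [hl2, ← mul_assoc, h2] at h1
    exact h1.trans (mul_le_mul_right (eA.tsum_rpow_subadditive eB e hq (by linarith)) _)
  have lower : 2 ≤ p →
      2 * (∑' i, (lA i : ℝ≥0∞) ^ (p / 2) + ∑' i, (lB i : ℝ≥0∞) ^ (p / 2)) ≤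
        ∑' i, (lX i : ℝ≥0∞) ^ (p / 2) + ∑' i, (lY i : ℝ≥0∞) ^ (p / 2) := fun hp2 => by
    have h1 := eX.tsum_rpow_add_le_mul eY e2 (q := p / 2) (by linarith)
    rw [hl2] at h1
    calc _ ≤ 2 * ∑' i, (l i : ℝ≥0∞) ^ (p / 2) := by
          gcongr
          exact eA.tsum_rpow_superadditive eB e (by linarith)
      _ = 2 ^ (1 - p / 2) * (2 ^ (p / 2) * ∑' i, (l i : ℝ≥0∞) ^ (p / 2)) := by
          rw [← mul_assoc, h2]
      _ ≤ _ := by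
          refine (mul_le_mul_right h1 _).trans_eq ?_
          rw [← mul_assoc, ← ENNReal.rpow_add _ _ two_ne_zero ENNReal.ofNat_ne_top]
          simp
  have finite : ∑' i, (lX i : ℝ≥0∞) ^ (p / 2) + ∑' i, (lY i : ℝ≥0∞) ^ (p / 2) ≠ ∞ := by
    rw [← sA] at hfA
    rw [← sB] at hfB
    rcases le_total p 2 with hp2 | hp2
    · exact ne_top_of_le_ne_top
        (ENNReal.mul_ne_top ENNReal.ofNat_ne_top (ENNReal.add_ne_top.2 ⟨hfA, hfB⟩)) (upper hp2)
    -- For `p ≥ 2` the main estimate bounds `A ± B` from below only; finiteness comes from the other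
    -- half of each trace inequality.
    · have h1 := eX.tsum_rpow_superadditive eY e2 (q := p / 2) (by linarith)
      rw [hl2] at h1
      refine ne_top_of_le_ne_top ?_ (h1.trans (mul_le_mul_right
        (eA.tsum_rpow_add_le_mul eB e (by linarith)) _))
      exact ENNReal.mul_ne_top (hpow _)
        (ENNReal.mul_ne_top (hpow _) (ENNReal.add_ne_top.2 ⟨hfA, hfB⟩))
  rw [sX, sY] at finite
  have hX : Mem p (A + B) := mem_iff.2 ⟨hadd, (ENNReal.add_ne_top.1 finite).1⟩
  have hY : Mem p (A - B) := mem_iff.2 ⟨hsub, (ENNReal.add_ne_top.1 finite).2⟩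
  have nA := tsum_singularValue_rpow_nonneg p A
  have nB := tsum_singularValue_rpow_nonneg p B
  have nX := tsum_singularValue_rpow_nonneg p (A + B)
  have nY := tsum_singularValue_rpow_nonneg p (A - B)
  have h2' : (2 : ℝ≥0∞) = ENNReal.ofReal 2 := by simp
  rw [sA, sB, sX, sY, hA.tsum_ofReal, hB.tsum_ofReal, hX.tsum_ofReal, hY.tsum_ofReal, h2',
    ← ENNReal.ofReal_add nA nB, ← ENNReal.ofReal_add nX nY,
    ← ENNReal.ofReal_mul zero_le_two] at upper lower
  exact ⟨hX, hY, fun h => (ENNReal.ofReal_le_ofReal_iff (by positivity)).1 (lower h),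
    fun h => (ENNReal.ofReal_le_ofReal_iff (by positivity)).1 (upper h)⟩

end Schatten

/-! ### Scalar inequalities and conclusion -/

theorem Real.sq_rpow_half {u p : ℝ} (hu : 0 ≤ u) : (u ^ 2) ^ (p / 2) = u ^ p := by
  rw [← Real.rpow_natCast, ← Real.rpow_mul hu]
  congr 1
  push_cast
  ring

theorem Real.two_rpow_sub_mul_rpow_half {p N : ℝ} (hN : 0 ≤ N) :
    (2 : ℝ) ^ (2 - p / 2) * N ^ (p / 2) = 4 * (N / 2) ^ (p / 2) := by
  rw [Real.rpow_sub two_pos, Real.div_rpow hN zero_le_two, Real.rpow_two]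
  ring

theorem Real.two_rpow_sub_one_mul {p N : ℝ} (hp : 0 < p) (hN : 0 ≤ N) :
    (2 : ℝ) ^ (2 / p - 1) * N = (4 * (N / 2) ^ (p / 2) / 2) ^ (2 / p) := by
  have h : 4 * (N / 2) ^ (p / 2) / 2 = 2 * (N / 2) ^ (p / 2) := by ring
  rw [h, Real.mul_rpow zero_le_two (by positivity), ← Real.rpow_mul (by positivity),
    div_mul_div_cancel₀ two_ne_zero, div_self hp.ne', Real.rpow_one, Real.rpow_sub two_pos,
    Real.rpow_one]
  ring

theorem Real.four_mul_midpoint_rpow_le {q a b : ℝ} (hq : 1 ≤ q) (ha : 0 ≤ a) (hb : 0 ≤ b) :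
    4 * ((a + b) / 2) ^ q ≤ 2 * (a ^ q + b ^ q) := by
  have h := (convexOn_rpow hq).2 (Set.mem_Ici.2 ha) (Set.mem_Ici.2 hb)
    one_half_pos.le one_half_pos.le (add_halves (1 : ℝ))
  simp only [smul_eq_mul, ← mul_add] at h
  rw [one_div_mul_eq_div (2 : ℝ) (a + b)] at h
  linarith

theorem Real.le_four_mul_midpoint_rpow {q a b : ℝ} (hq0 : 0 ≤ q) (hq : q ≤ 1) (ha : 0 ≤ a)
    (hb : 0 ≤ b) : 2 * (a ^ q + b ^ q) ≤ 4 * ((a + b) / 2) ^ q := by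
  have h := (Real.concaveOn_rpow hq0 hq).2 (Set.mem_Ici.2 ha) (Set.mem_Ici.2 hb)
    one_half_pos.le one_half_pos.le (add_halves (1 : ℝ))
  simp only [smul_eq_mul, ← mul_add] at h
  rw [one_div_mul_eq_div (2 : ℝ) (a + b)] at h
  linarith

theorem theorem1p11 {H : Type*} [NormedAddCommGroup H] [InnerProductSpace ℂ H] [CompleteSpace H]
    (p : ℝ) (hp : 0 < p) (A B : H →L[ℂ] H)
    (hA : Schatten.Mem p A) (hB : Schatten.Mem p B) :
    Schatten.Mem p (A + B) ∧ Schatten.Mem p (A - B) ∧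
    (2 ≤ p →
      (2 : ℝ) ^ (2 - p / 2) *
          (Schatten.schattenNorm p A ^ 2 + Schatten.schattenNorm p B ^ 2) ^ (p / 2) ≤
        Schatten.schattenNorm p (A + B) ^ p + Schatten.schattenNorm p (A - B) ^ p ∧
      (2 : ℝ) ^ (2 / p - 1) *
          (Schatten.schattenNorm p A ^ 2 + Schatten.schattenNorm p B ^ 2) ≤
        ((Schatten.schattenNorm p (A + B) ^ p + Schatten.schattenNorm p (A - B) ^ p) / 2)
          ^ (2 / p)) ∧
    (p ≤ 2 →
      Schatten.schattenNorm p (A + B) ^ p + Schatten.schattenNorm p (A - B) ^ p ≤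
        (2 : ℝ) ^ (2 - p / 2) *
          (Schatten.schattenNorm p A ^ 2 + Schatten.schattenNorm p B ^ 2) ^ (p / 2) ∧
      ((Schatten.schattenNorm p (A + B) ^ p + Schatten.schattenNorm p (A - B) ^ p) / 2)
          ^ (2 / p) ≤
        (2 : ℝ) ^ (2 / p - 1) *
          (Schatten.schattenNorm p A ^ 2 + Schatten.schattenNorm p B ^ 2)) := by
  have hq : 0 < p / 2 := half_pos hp
  obtain ⟨hadd, hsub, lower, upper⟩ := Schatten.tsum_singularValue_rpow_add_sub hp hA hB
  simp only [← Schatten.schattenNorm_rpow hp] at lower upper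
  have nA := Schatten.schattenNorm_nonneg p A
  have nB := Schatten.schattenNorm_nonneg p B
  have nX := Real.rpow_nonneg (Schatten.schattenNorm_nonneg p (A + B)) p
  have nY := Real.rpow_nonneg (Schatten.schattenNorm_nonneg p (A - B)) p
  rw [← Real.sq_rpow_half nA, ← Real.sq_rpow_half nB] at lower upper
  -- Both forms are written through `4 * (N / 2) ^ (p / 2)`, `N = ‖A‖_p² + ‖B‖_p²`; the second then
  -- follows from the first by halving and taking the power `2 / p`.
  rw [Real.two_rpow_sub_mul_rpow_half (by positivity),
    Real.two_rpow_sub_one_mul hp (by positivity)]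
  refine ⟨hadd, hsub, fun h => ?_, fun h => ?_⟩
  · have h1 := Real.four_mul_midpoint_rpow_le (by linarith : 1 ≤ p / 2)
      (sq_nonneg (Schatten.schattenNorm p A)) (sq_nonneg (Schatten.schattenNorm p B))
    have h2 := h1.trans (lower h)
    exact ⟨h2, by gcongr⟩
  · have h1 := Real.le_four_mul_midpoint_rpow hq.le (by linarith : p / 2 ≤ 1)
      (sq_nonneg (Schatten.schattenNorm p A)) (sq_nonneg (Schatten.schattenNorm p B))
    have h2 := (upper h).trans h1
    exact ⟨h2, by gcongr⟩
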